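/- Let $F$ be the free group on $a,b$, let $|s|$ denote word length with respect to $\{a^{\pm1},b^{\pm1}\}$, let $\mathbb T=\mathbb R/\mathbb Z$, and let $f=3-a-b\in\mathbb ZF$. For any set $A$ the (left) shift of $F$ on $A^F$ is given by $(s\cdot x)_t=x_{s^{-1}t}$. Let $X_f\subset\mathbb T^F$ be the annihilator of the left ideal $\mathbb ZF f$ under the pairing $\langle x,g\rangle=\sum_{s\in F} g_s x_s$ ($x\in\mathbb T^F$, $g\in\mathbb ZF$), so that $X_f$ is the compact dual group of $\mathbb ZF/\mathbb ZFf$. Let $\alpha_f$ be the restriction of the shift to $X_f$, and $\mu_f$ the normalized Haar measure of $X_f$. Let $Y=\{0,1,2\}^F$, with the shift $\sigma$ and the product measure $\nu$ giving each symbol measure $1/3$ (the full, or Bernoulli, 3-shift over $F$). Let $w^\Delta:F\to\mathbb R$ be given by $w^\Delta_s=\tfrac13\,3^{-|s|}$ if $s$ is a (possibly empty) word in $a^{-1}$ and $b^{-1}$, and $w^\Delta_s=0$ otherwise, and let $x^\Delta=w^\Delta \bmod 1\in\mathbb T^F$. Theorem. For every $d\in Y$ and $s\in F$ the series $(d\cdot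 w^\Delta)_s=\sum_{t\in F}d_t\,w^\Delta_{t^{-1}s}$ converges unconditionally in $\mathbb R$ and $(d\cdot x^\Delta)_s=\sum_{t\in F}d_t\,x^\Delta_{t^{-1}s}$ converges unconditionally in $\mathbb T$. The homoclinic map $\phi(d)=(d\cdot w^\Delta \bmod 1)=d\cdot x^\Delta$ takes values in $X_f$, and $\phi:Y\to X_f$ is continuous, equivariant ($\phi\circ\sigma^s=\alpha_f^s\circ\phi$ for all $s\in F$) and surjective. There is a set $E\subset Y$ with $\nu(E)=0$ such that $\phi$ is one-to-one on $Y\setminus E$, and $\phi_*\nu=\mu_f$. Hence $\phi$ is a measurable isomorphism between the Bernoulli 3-shift $(Y,\sigma,\nu)$ and $(X_f,\alpha_f,\mu_f)$: it is measure preserving, and it restricts to an equivariant bijection with measurable inverse between invariant measurable sets of full measure in $Y$ and in $X_f$. -/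

import Mathlib

noncomputable section

namespace AlgAct

open MeasureTheory Set

section General

variable {Γ : Type*} [Group Γ]

set_option linter.unusedSectionVars false

/-- The left shift `(σ^s x)_t = x_{s⁻¹ t}` on `A^Γ`. -/
def shift {A : Type*} (s : Γ) (x : Γ → A) : Γ → A := fun t => x (s⁻¹ * t)

/-- The dual pairing `⟨x, g⟩ = ∑ g_s x_s` between `𝕋^Γ` and the integral group ring `ℤΓ`. -/
def pairing (x : Γ → UnitAddCircle) (g : MonoidAlgebra ℤ Γ) : UnitAddCircle :=
  g.coeff.sum fun s n => n • x s

theorem pairing_add_left (x y : Γ → UnitAddCircle) (g : MonoidAlgebra ℤ Γ) :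
    pairing (x + y) g = pairing x g + pairing y g := by
  simp [pairing, Finsupp.sum, Finset.sum_add_distrib]

theorem pairing_neg_left (x : Γ → UnitAddCircle) (g : MonoidAlgebra ℤ Γ) :
    pairing (-x) g = -pairing x g := by
  simp [pairing, Finsupp.sum]

theorem pairing_add_right (x : Γ → UnitAddCircle) (g h : MonoidAlgebra ℤ Γ) :
    pairing x (g + h) = pairing x g + pairing x h := by
  unfold pairing
  rw [MonoidAlgebra.coeff_add]
  exact Finsupp.sum_add_index' (by simp) (by intros; rw [add_zsmul])

theorem pairing_single (x : Γ → UnitAddCircle) (s : Γ) (n : ℤ) :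
    pairing x (MonoidAlgebra.single s n) = n • x s := by
  simp [pairing]

theorem pairing_shift (s : Γ) (x : Γ → UnitAddCircle) (g : MonoidAlgebra ℤ Γ) :
    pairing (shift s x) g = pairing x (MonoidAlgebra.single s⁻¹ 1 * g) := by
  induction g using MonoidAlgebra.induction_linear with
  | zero => simp [pairing]
  | add g h hg hh => rw [mul_add, pairing_add_right, pairing_add_right, hg, hh]
  | single t n =>
    rw [MonoidAlgebra.single_mul_single, pairing_single, pairing_single, one_mul]
    rfl

/-- `X_f`: the dual group of `ℤΓ / ℤΓ f`, i.e. the annihilator in `𝕋^Γ` of the left ideal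
`ℤΓ f` (in Mathlib `Ideal` means left ideal). -/
def principalGroup (f : MonoidAlgebra ℤ Γ) : AddSubgroup (Γ → UnitAddCircle) where
  carrier := {x | ∀ g ∈ Ideal.span {f}, pairing x g = 0}
  zero_mem' := fun g _ => by simp [pairing]
  add_mem' := fun hx hy g hg => by rw [pairing_add_left, hx g hg, hy g hg, add_zero]
  neg_mem' := fun hx g hg => by rw [pairing_neg_left, hx g hg, neg_zero]

theorem shift_mem (f : MonoidAlgebra ℤ Γ) (s : Γ) {x : Γ → UnitAddCircle}
    (hx : x ∈ principalGroup f) : shift s x ∈ principalGroup f := fun g hg => by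
  rw [pairing_shift]
  exact hx _ (Ideal.mul_mem_left _ _ hg)

theorem continuous_shift_restrict (f : MonoidAlgebra ℤ Γ) (s : Γ) :
    Continuous fun x : principalGroup f =>
      (⟨shift s x.1, shift_mem f s x.2⟩ : principalGroup f) :=
  Continuous.subtype_mk (f := fun x : principalGroup f => shift s x.1)
    (continuous_pi fun t => (continuous_apply (s⁻¹ * t)).comp continuous_subtype_val) _

/-- The principal algebraic action `α_f`: the restriction of the shift to `X_f`, acting by
continuous automorphisms. -/
def principalAction (f : MonoidAlgebra ℤ Γ) (s : Γ) : principalGroup f ≃ₜ+ principalGroup f where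
  toFun x := ⟨shift s x.1, shift_mem f s x.2⟩
  invFun x := ⟨shift s⁻¹ x.1, shift_mem f s⁻¹ x.2⟩
  left_inv x := by ext t; simp [shift]
  right_inv x := by ext t; simp [shift]
  map_add' x y := rfl
  continuous_toFun := continuous_shift_restrict f s
  continuous_invFun := continuous_shift_restrict f s⁻¹

theorem principalAction_apply (f : MonoidAlgebra ℤ Γ) (s : Γ) (x : principalGroup f) (t : Γ) :
    (principalAction f s x).1 t = x.1 (s⁻¹ * t) := rfl

theorem principalAction_one (f : MonoidAlgebra ℤ Γ) (x : principalGroup f) :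
    principalAction f 1 x = x := by
  ext t; simp [principalAction_apply]

theorem principalAction_mul (f : MonoidAlgebra ℤ Γ) (s u : Γ) (x : principalGroup f) :
    principalAction f (s * u) x = principalAction f s (principalAction f u x) := by
  ext t; simp [principalAction_apply, mul_assoc]

theorem isClosed_principalGroup (f : MonoidAlgebra ℤ Γ) :
    IsClosed (principalGroup f : Set (Γ → UnitAddCircle)) := by
  have : (principalGroup f : Set (Γ → UnitAddCircle)) =
      ⋂ g ∈ Ideal.span {f}, {x | pairing x g = 0} := by
    ext x; simp [principalGroup]
  rw [this]
  refine isClosed_biInter fun g _ => isClosed_eq ?_ continuous_const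
  exact continuous_finsetSum _ fun s _ => (continuous_apply s).zsmul _

instance (f : MonoidAlgebra ℤ Γ) : CompactSpace (principalGroup f) :=
  isCompact_iff_compactSpace.mp (isClosed_principalGroup f).isCompact

/-- The Haar measure `μ_f` of the compact group `X_f`, normalized to total mass `1`. -/
def principalHaar [Countable Γ] (f : MonoidAlgebra ℤ Γ) : Measure (principalGroup f) :=
  Measure.addHaarMeasure ⊤

/-- The product `d · w` for `d : Γ → ℤ` and `w : Γ → A`, that is
`(d · w)_s = ∑_t d_t w_{t⁻¹ s}`, where the sum is unconditional. -/
def formalProduct {A : Type*} [AddCommGroup A] [TopologicalSpace A]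
    (d : Γ → ℤ) (w : Γ → A) : Γ → A :=
  fun s => ∑' t, d t • w (t⁻¹ * s)

/-- `φ : Y → X` is a measurable isomorphism of the `Γ`-actions `σ` on `(Y, ν)` and `α` on
`(X, μ)`: it is measure preserving, and it restricts to an equivariant bijection with measurable
inverse between invariant measurable sets of full measure. -/
structure IsMeasurableIsomorphism {Y X : Type*} [MeasurableSpace Y] [MeasurableSpace X]
    (σ : Γ → Y → Y) (ν : Measure Y) (α : Γ → X → X) (μ : Measure X) (φ : Y → X) : Prop where
  measurePreserving : MeasurePreserving φ ν μ
  exists_inverse : ∃ (Y₀ : Set Y) (X₀ : Set X) (ψ : X → Y),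
    MeasurableSet Y₀ ∧ ν Y₀ᶜ = 0 ∧ (∀ s, ∀ y ∈ Y₀, σ s y ∈ Y₀) ∧
    MeasurableSet X₀ ∧ μ X₀ᶜ = 0 ∧ (∀ s, ∀ x ∈ X₀, α s x ∈ X₀) ∧
    BijOn φ Y₀ X₀ ∧ InvOn ψ φ Y₀ X₀ ∧ Measurable ψ ∧
    ∀ s, ∀ y ∈ Y₀, φ (σ s y) = α s (φ y)

end General

/-- The free group of rank two. -/
abbrev F : Type := FreeGroup (Fin 2)

/-- The first free generator. -/
def a : F := FreeGroup.of 0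

/-- The second free generator. -/
def b : F := FreeGroup.of 1

/-- The element `f = 3 - a - b` of the integral group ring of `F`. -/
def f : MonoidAlgebra ℤ F := 3 - MonoidAlgebra.of ℤ F a - MonoidAlgebra.of ℤ F b

/-- `w^Δ = (1/3) ∑_{s ∈ N} 3^{-|s|} s`, where `N` is the set of all words in `a⁻¹, b⁻¹`
(including the empty one) and `|s|` is the word length; this is the inverse of
`f^* = 3 - a⁻¹ - b⁻¹` in `ℓ¹(F, ℝ)`. -/
def wΔ : F → ℝ :=
  indicator (Submonoid.closure {a⁻¹, b⁻¹} : Set F) fun s => (1 / 3) * (1 / 3) ^ s.norm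

/-- Coordinatewise reduction modulo one. -/
def proj (v : F → ℝ) : F → UnitAddCircle := fun s => (v s : UnitAddCircle)

/-- The point `x^Δ = π(w^Δ)`. -/
def xΔ : F → UnitAddCircle := proj wΔ

/-- The homoclinic map `φ(d) = π(d · w^Δ)` (to be used for bounded `d`). -/
def homoclinicMap (d : F → ℤ) : F → UnitAddCircle := proj (formalProduct d wΔ)

/-- The full 3-shift space `{0,1,2}^F`, with its product topology and product σ-algebra. -/
abbrev Y : Type := F → Fin 3

/-- The inclusion of `{0,1,2}^F` into `ℤ^F`. -/
def Y.toInt (d : Y) : F → ℤ := fun s => ((d s : ℕ) : ℤ)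

/-- The product measure on `{0,1,2}^F` giving each symbol measure `1/3`. -/
def ν : Measure Y := Measure.infinitePi fun _ : F => (PMF.uniformOfFintype (Fin 3)).toMeasure

end AlgAct

end

noncomputable section

namespace AlgAct

open MeasureTheory Set

/-! A point x lies in X_f iff 3x_s = x_{sa} + x_{sb} for all s. Since `wΔ` inverts 3 - a⁻¹ - b⁻¹ in
ℓ¹, v = d · wΔ is the only bounded real solution of 3v_s - v_{sa} - v_{sb} = d_s, and its values lie
in [0, 2] (`lift_recurrence`, `eq_zero_of_bounded`).

Surjectivity: once x_{sa} and x_{sb} are lifted to ℝ, some digit in {0,1,2} yields a lift of x_s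
(`exists_digit`). Doing this below height n, starting from arbitrary lifts, and letting n grow by
compactness gives a bounded lift of x with digits d; by uniqueness it is d · wΔ.

Image measure: Fourier coefficients are compared. The character of g, composed with `phi`, is d ↦ ∑
d_t c_t with c = g (f^*)⁻¹ mod 1. If c = 0, the character is trivial on X_f. Otherwise a nonzero c_t
of least height is 3-torsion (`exists_coefficient_torsion`), and rotating the symbol at t multiplies
the character by a constant other than 1, so its integral vanishes for `ν`, and likewise for Haar
measure.

Injectivity: if `phi d = phi d'`, the difference k of the lifts is integral, bounded by 2, and
satisfies 3k_s = k_{sa} + k_{sb} + d_s - d'_s. A nonzero value of k must propagate to infinity along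
a tree on which the symbols of d are constrained (`nonpos_of_not_percolates`); such trees occur with
probability zero (`measureReal_percolates_le`). -/

/-! ### Positive words and the inverse of 3 - a⁻¹ - b⁻¹. -/

/-- The generators `a`, `b` of `F` as a family. -/
def gen (i : Fin 2) : F := FreeGroup.of i

/-- The positive word in `a`, `b` spelled by a list. -/
def posWord (l : List (Fin 2)) : F := FreeGroup.mk (l.map fun i => (i, true))

theorem toWord_posWord (l : List (Fin 2)) : (posWord l).toWord = l.map fun i => (i, true) := by
  rw [posWord, FreeGroup.toWord_mk]
  apply FreeGroup.IsReduced.reduce_eq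
  rw [FreeGroup.IsReduced, List.isChain_map]
  induction l with
  | nil => simp
  | cons i l ih => cases l <;> simp_all

theorem posWord_injective : Function.Injective posWord := fun l l' h => by
  have := congrArg FreeGroup.toWord h
  rw [toWord_posWord, toWord_posWord] at this
  exact List.map_injective_iff.2 (fun i j hij => by simpa using hij) this

theorem norm_posWord (l : List (Fin 2)) : (posWord l).norm = l.length := by
  rw [FreeGroup.norm, toWord_posWord, List.length_map]

@[simp] theorem posWord_nil : posWord [] = 1 := rfl

theorem posWord_append (l l' : List (Fin 2)) : posWord (l ++ l') = posWord l * posWord l' := by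
  simp [posWord, FreeGroup.mul_mk]

theorem posWord_singleton (i : Fin 2) : posWord [i] = gen i := rfl

theorem posWord_cons (i : Fin 2) (l : List (Fin 2)) : posWord (i :: l) = gen i * posWord l := by
  rw [← posWord_singleton, ← posWord_append]; rfl

theorem posWord_concat (i : Fin 2) (l : List (Fin 2)) :
    posWord (l ++ [i]) = posWord l * gen i := by
  rw [← posWord_singleton, ← posWord_append]

theorem mem_closure_iff (s : F) :
    s ∈ (Submonoid.closure {a⁻¹, b⁻¹} : Set F) ↔ ∃ l, s = (posWord l)⁻¹ := by
  constructor
  · intro hs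
    induction hs using Submonoid.closure_induction with
    | mem x hx =>
      rcases hx with rfl | rfl
      · exact ⟨[0], rfl⟩
      · exact ⟨[1], rfl⟩
    | one => exact ⟨[], by simp⟩
    | mul x y _ _ hx hy =>
      obtain ⟨l, rfl⟩ := hx
      obtain ⟨l', rfl⟩ := hy
      exact ⟨l' ++ l, by rw [posWord_append, mul_inv_rev]⟩
  · rintro ⟨l, rfl⟩
    induction l with
    | nil => simp
    | cons i l ih =>
      rw [posWord_cons, mul_inv_rev]
      refine Submonoid.mul_mem _ ih (Submonoid.subset_closure ?_)
      fin_cases i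
      · exact Or.inl rfl
      · exact Or.inr rfl

theorem wΔ_posWord_inv (l : List (Fin 2)) :
    wΔ (posWord l)⁻¹ = (1 / 3) * (1 / 3) ^ l.length := by
  rw [wΔ, indicator_of_mem ((mem_closure_iff _).2 ⟨l, rfl⟩), FreeGroup.norm_inv_eq, norm_posWord]

theorem wΔ_eq_zero {s : F} (hs : ∀ l, s ≠ (posWord l)⁻¹) : wΔ s = 0 :=
  indicator_of_notMem (fun h => by
    obtain ⟨l, hl⟩ := (mem_closure_iff s).1 h
    exact hs l hl) _

theorem wΔ_nonneg (s : F) : 0 ≤ wΔ s :=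
  indicator_nonneg (fun _ _ => by positivity) _

theorem wΔ_one : wΔ 1 = 1 / 3 := by simpa using wΔ_posWord_inv []

theorem gen_ne_posWord_inv (i : Fin 2) (l : List (Fin 2)) : gen i ≠ (posWord l)⁻¹ := by
  intro h
  have : posWord (i :: l) = posWord [] := by rw [posWord_cons, h]; simp
  simpa using posWord_injective this

/-- `w^Δ` is a right inverse of `3 - a⁻¹ - b⁻¹`. -/
theorem wΔ_mul_gen (s : F) :
    3 * wΔ s - wΔ (s * gen 0) - wΔ (s * gen 1) = if s = 1 then 1 else 0 := by
  by_cases hs : ∃ l, s = (posWord l)⁻¹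
  · obtain ⟨l, rfl⟩ := hs
    cases l with
    | nil =>
      have h (i) : wΔ (gen i) = 0 := wΔ_eq_zero (gen_ne_posWord_inv i)
      simp [wΔ_one, h]
    | cons i l =>
      -- The last letter of the word is the inverse of `gen i`: right multiplication by `gen j`
      -- cancels it if j = i and otherwise leaves the support of `wΔ`.
      have h1 (j) (hj : j ≠ i) : wΔ ((posWord (i :: l))⁻¹ * gen j) = 0 := by
        refine wΔ_eq_zero fun l' hl' => hj ?_
        have : posWord (j :: l') = posWord (i :: l) := by
          rw [posWord_cons j, ← inv_inv (posWord l'), ← hl']; group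
        simpa using (List.cons.inj (posWord_injective this)).1
      have h2 : wΔ ((posWord (i :: l))⁻¹ * gen i) = (1 / 3) * (1 / 3) ^ l.length := by
        rw [← wΔ_posWord_inv, posWord_cons]; congr 1; group
      have h3 : (posWord (i :: l))⁻¹ ≠ 1 := by
        rw [ne_eq, inv_eq_one, ← posWord_nil]
        exact fun h => by simpa using posWord_injective h
      have h4 : 3 * wΔ (posWord (i :: l))⁻¹ = (1 / 3) * (1 / 3) ^ l.length := by
        rw [wΔ_posWord_inv, List.length_cons, pow_succ]; ring
      rw [if_neg h3, h4]
      fin_cases i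
      · rw [h1 1 (by decide)]; simp at h2 ⊢; rw [h2]; ring
      · rw [h1 0 (by decide)]; simp at h2 ⊢; rw [h2]; ring
  · push Not at hs
    have h (i) : wΔ (s * gen i) = 0 := by
      refine wΔ_eq_zero fun l hl => hs (i :: l) ?_
      rw [posWord_cons, mul_inv_rev, ← hl]; group
    rw [wΔ_eq_zero hs, h, h, if_neg (by rintro rfl; exact hs [] (by simp))]
    simp

/-- `w^Δ` is a left inverse of `3 - a⁻¹ - b⁻¹`. -/
theorem wΔ_gen_mul (s : F) :
    3 * wΔ s - wΔ (gen 0 * s) - wΔ (gen 1 * s) = if s = 1 then 1 else 0 := by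
  by_cases hs : ∃ l, s = (posWord l)⁻¹
  · obtain ⟨l, rfl⟩ := hs
    cases l using List.reverseRecOn with
    | nil =>
      have h (i) : wΔ (gen i) = 0 := wΔ_eq_zero (gen_ne_posWord_inv i)
      simp [wΔ_one, h]
    | append_singleton l i =>
      have h1 (j) (hj : j ≠ i) : wΔ (gen j * (posWord (l ++ [i]))⁻¹) = 0 := by
        refine wΔ_eq_zero fun l' hl' => hj ?_
        have : posWord (l' ++ [j]) = posWord (l ++ [i]) := by
          rw [posWord_concat j, ← inv_inv (posWord l'), ← hl']; group
        simpa using (List.append_inj' (posWord_injective this) rfl).2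
      have h2 : wΔ (gen i * (posWord (l ++ [i]))⁻¹) = (1 / 3) * (1 / 3) ^ l.length := by
        rw [← wΔ_posWord_inv, posWord_concat]; congr 1; group
      have h3 : (posWord (l ++ [i]))⁻¹ ≠ 1 := by
        rw [ne_eq, inv_eq_one, ← posWord_nil]
        exact fun h => by simpa using posWord_injective h
      have h4 : 3 * wΔ (posWord (l ++ [i]))⁻¹ = (1 / 3) * (1 / 3) ^ l.length := by
        rw [wΔ_posWord_inv, List.length_append, List.length_singleton, pow_succ]; ring
      rw [if_neg h3, h4]
      fin_cases i
      · rw [h1 1 (by decide)]; simp at h2 ⊢; rw [h2]; ring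
      · rw [h1 0 (by decide)]; simp at h2 ⊢; rw [h2]; ring
  · push Not at hs
    have h (i) : wΔ (gen i * s) = 0 := by
      refine wΔ_eq_zero fun l hl => hs (l ++ [i]) ?_
      rw [posWord_concat, mul_inv_rev, ← hl]; group
    rw [wΔ_eq_zero hs, h, h, if_neg (by rintro rfl; exact hs [] (by simp))]
    simp

/-! ### Summability and total mass of `wΔ`. -/

theorem summable_pow_length :
    Summable fun l : List (Fin 2) => (1 / 3 : ℝ) * (1 / 3) ^ l.length := by
  rw [← List.equivSigmaTuple.symm.summable_iff]
  rw [summable_sigma_of_nonneg fun _ => by simp only [Function.comp_apply]; positivity]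
  have h (n : ℕ) (g : Fin n → Fin 2) : (1 / 3 : ℝ) * (1 / 3) ^
      (List.equivSigmaTuple.symm ⟨n, g⟩ : List (Fin 2)).length = (1 / 3) * (1 / 3) ^ n := by
    congr 2; exact List.length_ofFn
  refine ⟨fun n => (hasSum_fintype _).summable, ?_⟩
  -- There are 2^n words of length n, each of weight (1/3)·3^(-n).
  have : Summable fun n : ℕ => (1 / 3 : ℝ) * (2 / 3) ^ n :=
    (summable_geometric_of_lt_one (by norm_num) (by norm_num)).mul_left _
  refine this.congr fun n => ?_
  rw [tsum_fintype]
  simp only [Function.comp_apply, h, Finset.sum_const, Finset.card_univ, Fintype.card_fun,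
    Fintype.card_fin, nsmul_eq_mul, Nat.cast_pow, Nat.cast_ofNat]
  rw [mul_left_comm, ← mul_pow]; norm_num

theorem summable_wΔ : Summable wΔ := by
  have hinj : Function.Injective fun l => (posWord l)⁻¹ :=
    inv_injective.comp posWord_injective
  rw [← hinj.summable_iff]
  · exact summable_pow_length.congr fun l => (wΔ_posWord_inv l).symm
  · exact fun s hs => wΔ_eq_zero fun l hl => hs ⟨l, hl.symm⟩

/-- Summing `wΔ_mul_gen` over the group gives 3S - S - S = 1 for the total S. -/
theorem tsum_wΔ : ∑' s, wΔ s = 1 := by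
  have h0 (i) : Summable fun s => wΔ (s * gen i) :=
    (Equiv.mulRight (gen i)).summable_iff.2 summable_wΔ
  have h1 (i) : ∑' s, wΔ (s * gen i) = ∑' s, wΔ s := (Equiv.mulRight (gen i)).tsum_eq wΔ
  have h2 := tsum_congr (L := .unconditional F) wΔ_mul_gen
  rw [tsum_ite_eq, ((summable_wΔ.mul_left 3).sub (h0 0)).tsum_sub (h0 1),
    (summable_wΔ.mul_left 3).tsum_sub (h0 0), h1, h1, tsum_mul_left] at h2
  linarith

/-- The homomorphism `F → ℤ` sending both generators to `1`. -/
def height (s : F) : ℤ := (FreeGroup.lift (fun _ => Multiplicative.ofAdd (1 : ℤ)) s).toAdd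

theorem height_mul (s t : F) : height (s * t) = height s + height t := by simp [height]

theorem height_inv (s : F) : height s⁻¹ = -height s := by simp [height]

@[simp] theorem height_one : height 1 = 0 := by simp [height]

@[simp] theorem height_gen (i : Fin 2) : height (gen i) = 1 := by simp [height, gen]

theorem height_posWord (l : List (Fin 2)) : height (posWord l) = l.length := by
  induction l with
  | nil => simp
  | cons i l ih => rw [posWord_cons, height_mul, ih, height_gen]; simp; ring

theorem height_nonpos_of_wΔ_ne_zero {s : F} (hs : wΔ s ≠ 0) : height s ≤ 0 := by
  by_contra h
  refine hs (wΔ_eq_zero ?_)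
  rintro l rfl
  rw [height_inv, height_posWord] at h
  omega

/-! ### The real configuration d · wΔ and its recurrence. -/

theorem Y.toInt_nonneg (d : Y) (t : F) : 0 ≤ d.toInt t := by simp [Y.toInt]

theorem Y.toInt_le_two (d : Y) (t : F) : d.toInt t ≤ 2 := by
  have := (d t).isLt
  simp only [Y.toInt]; omega

theorem Y.toInt_injective : Function.Injective Y.toInt := fun d d' h => by
  funext t
  have := congrFun h t
  simp only [Y.toInt] at this
  exact Fin.ext (by omega)

theorem summable_wΔ_translate (s : F) : Summable fun t : F => wΔ (t⁻¹ * s) :=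
  ((Equiv.inv F).trans (Equiv.mulRight s)).summable_iff.2 summable_wΔ

theorem tsum_wΔ_translate (s : F) : ∑' t : F, wΔ (t⁻¹ * s) = 1 :=
  (((Equiv.inv F).trans (Equiv.mulRight s)).tsum_eq wΔ).trans tsum_wΔ

theorem toInt_smul_le (d : Y) (s t : F) : d.toInt t • wΔ (t⁻¹ * s) ≤ 2 * wΔ (t⁻¹ * s) := by
  rw [zsmul_eq_mul]
  exact mul_le_mul_of_nonneg_right (by exact_mod_cast d.toInt_le_two t) (wΔ_nonneg _)

theorem toInt_smul_nonneg (d : Y) (s t : F) : 0 ≤ d.toInt t • wΔ (t⁻¹ * s) :=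
  zsmul_nonneg (wΔ_nonneg _) (d.toInt_nonneg t)

theorem summable_toInt_smul (d : Y) (s : F) :
    Summable fun t : F => d.toInt t • wΔ (t⁻¹ * s) :=
  .of_nonneg_of_le (toInt_smul_nonneg d s) (toInt_smul_le d s)
    ((summable_wΔ_translate s).mul_left 2)

/-- The real configuration `d · w^Δ`. -/
def lift (d : Y) : F → ℝ := formalProduct d.toInt wΔ

theorem lift_nonneg (d : Y) (s : F) : 0 ≤ lift d s := tsum_nonneg (toInt_smul_nonneg d s)

theorem lift_le_two (d : Y) (s : F) : lift d s ≤ 2 := by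
  have := (summable_toInt_smul d s).tsum_le_tsum (toInt_smul_le d s)
    ((summable_wΔ_translate s).mul_left 2)
  rwa [tsum_mul_left, tsum_wΔ_translate, mul_one] at this

theorem lift_recurrence (d : Y) (s : F) :
    3 * lift d s - lift d (s * gen 0) - lift d (s * gen 1) = d.toInt s := by
  have h := (((summable_toInt_smul d s).hasSum.mul_left 3).sub
    (summable_toInt_smul d (s * gen 0)).hasSum).sub (summable_toInt_smul d (s * gen 1)).hasSum
  refine h.tsum_eq.symm.trans (Eq.trans (tsum_congr fun t => ?_)
    (tsum_ite_eq s (fun _ => (d.toInt s : ℝ))))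
  have := wΔ_mul_gen (t⁻¹ * s)
  simp only [inv_mul_eq_one, zsmul_eq_mul, mul_assoc] at this ⊢
  split_ifs at this ⊢ with hst
  · subst hst
    linear_combination (d.toInt t : ℝ) * this
  · linear_combination (d.toInt t : ℝ) * this

/-- A bounded solution of `3 u_s = u_{sa} + u_{sb}` vanishes. -/
theorem eq_zero_of_bounded {u : F → ℝ} {C : ℝ} (hC : ∀ s, |u s| ≤ C)
    (hu : ∀ s, 3 * u s = u (s * gen 0) + u (s * gen 1)) (s : F) : u s = 0 := by
  -- Each use of the recurrence improves a uniform bound by the factor 2/3.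
  have key (n : ℕ) : ∀ s, |u s| ≤ (2 / 3) ^ n * C := by
    induction n with
    | zero => simpa using hC
    | succ n ih =>
      intro s
      have h0 := abs_le.1 (ih (s * gen 0))
      have h1 := abs_le.1 (ih (s * gen 1))
      have h2 := hu s
      rw [pow_succ, abs_le]
      constructor <;> linarith
  have hlim : Filter.Tendsto (fun n : ℕ => (2 / 3 : ℝ) ^ n * C) Filter.atTop (nhds (0 * C)) :=
    (tendsto_pow_atTop_nhds_zero_of_lt_one (by norm_num) (by norm_num)).mul_const C
  rw [zero_mul] at hlim
  exact abs_nonpos_iff.1 (ge_of_tendsto' hlim fun n => key n s)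

theorem eq_lift {d : Y} {v : F → ℝ} (hv0 : ∀ s, 0 ≤ v s) (hv2 : ∀ s, v s ≤ 2)
    (hv : ∀ s, 3 * v s - v (s * gen 0) - v (s * gen 1) = d.toInt s) : v = lift d := by
  funext s
  refine sub_eq_zero.1 (eq_zero_of_bounded (u := fun s => v s - lift d s) (C := 2)
    (fun s => abs_le.2 ⟨?_, ?_⟩) (fun s => ?_) s)
  · linarith [hv0 s, lift_le_two d s]
  · linarith [hv2 s, lift_nonneg d s]
  · linarith [hv s, lift_recurrence d s]

/-! ### The homoclinic map into X_f: continuity and equivariance. -/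

theorem pairing_sum (x : F → UnitAddCircle) (g : MonoidAlgebra ℤ F) :
    pairing x g = ∑ s ∈ g.coeff.support, g.coeff s • x s := rfl

theorem pairing_mul_f (x : F → UnitAddCircle) (s : F) (n : ℤ) :
    pairing x (MonoidAlgebra.single s n * f) =
      n • ((3 : ℤ) • x s - x (s * gen 0) - x (s * gen 1)) := by
  have h3 : (3 : MonoidAlgebra ℤ F) = MonoidAlgebra.single 1 3 := rfl
  have hf : MonoidAlgebra.single s n * f = MonoidAlgebra.single s (n * 3) +
      (MonoidAlgebra.single (s * gen 0) (-n) + MonoidAlgebra.single (s * gen 1) (-n)) := by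
    rw [f, h3, MonoidAlgebra.of_apply, MonoidAlgebra.of_apply, mul_sub, mul_sub,
      MonoidAlgebra.single_mul_single, MonoidAlgebra.single_mul_single,
      MonoidAlgebra.single_mul_single, MonoidAlgebra.single_neg, MonoidAlgebra.single_neg]
    simp only [mul_one, a, b, gen]
    abel
  rw [hf, pairing_add_right, pairing_add_right, pairing_single, pairing_single, pairing_single,
    smul_sub, smul_sub, smul_smul]
  simp only [neg_smul]
  abel

theorem mem_principalGroup_iff (x : F → UnitAddCircle) :
    x ∈ principalGroup f ↔ ∀ s, (3 : ℤ) • x s - x (s * gen 0) - x (s * gen 1) = 0 := by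
  constructor
  · intro hx s
    have := hx _ (Ideal.mul_mem_left _ (MonoidAlgebra.single s 1) (Ideal.mem_span_singleton_self f))
    rwa [pairing_mul_f, one_smul] at this
  · intro hx g hg
    obtain ⟨h, rfl⟩ := Submodule.mem_span_singleton.1 hg
    rw [smul_eq_mul]
    clear hg
    induction h using MonoidAlgebra.induction_linear with
    | zero => simp [pairing]
    | add g h hg hh => rw [add_mul, pairing_add_right, hg, hh, add_zero]
    | single s n => rw [pairing_mul_f, hx, smul_zero]

theorem homoclinicMap_mem (d : Y) : homoclinicMap d.toInt ∈ principalGroup f := by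
  rw [mem_principalGroup_iff]
  intro s
  have h := congrArg (fun r : ℝ => (r : UnitAddCircle)) (lift_recurrence d s)
  simp only [AddCircle.coe_sub] at h
  have h3 : ((3 * lift d s : ℝ) : UnitAddCircle) = (3 : ℤ) • (lift d s : UnitAddCircle) := by
    rw [← AddCircle.coe_zsmul, zsmul_eq_mul]; norm_num
  rw [h3] at h
  refine h.trans ?_
  exact (AddCircle.coe_eq_zero_iff 1).2 ⟨d.toInt s, by simp⟩

/-- The homoclinic map as a map from the full shift to `X_f`. -/
def phi (d : Y) : principalGroup f := ⟨homoclinicMap d.toInt, homoclinicMap_mem d⟩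

theorem phi_apply (d : Y) (s : F) : (phi d).1 s = (lift d s : UnitAddCircle) := rfl

theorem hasSum_phi (d : Y) (s : F) :
    HasSum (fun t : F => d.toInt t • xΔ (t⁻¹ * s)) ((phi d).1 s) :=
  (summable_toInt_smul d s).hasSum.map (QuotientAddGroup.mk' (AddSubgroup.zmultiples (1 : ℝ)))
    (AddCircle.continuous_mk' 1)

theorem continuous_toInt (t : F) : Continuous fun d : Y => (d.toInt t : ℝ) :=
  (continuous_of_discreteTopology (f := fun i : Fin 3 => (((i : ℕ) : ℤ) : ℝ))).comp
    (continuous_apply t)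

theorem continuous_lift (s : F) : Continuous fun d => lift d s := by
  refine continuous_tsum (u := fun t : F => 2 * wΔ (t⁻¹ * s)) (fun t => ?_)
    ((summable_wΔ_translate s).mul_left 2) fun t d => ?_
  · simp only [zsmul_eq_mul]
    exact (continuous_toInt t).mul continuous_const
  · rw [Real.norm_of_nonneg (toInt_smul_nonneg d s t)]
    exact toInt_smul_le d s t

theorem continuous_phi : Continuous phi :=
  Continuous.subtype_mk (f := fun d : Y => homoclinicMap d.toInt)
    (continuous_pi fun s => (AddCircle.continuous_mk' 1).comp (continuous_lift s)) _

theorem lift_shift (s : F) (d : Y) (u : F) : lift (shift s d) u = lift d (s⁻¹ * u) := by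
  unfold lift formalProduct
  rw [← (Equiv.mulLeft s).tsum_eq]
  refine tsum_congr fun t => ?_
  simp [Y.toInt, shift, mul_assoc]

theorem phi_shift (s : F) (d : Y) : phi (shift s d) = principalAction f s (phi d) := by
  apply Subtype.ext
  funext u
  rw [principalAction_apply, phi_apply, phi_apply, lift_shift]

/-! ### Surjectivity. -/

/-- Given lifts of `x_{sa}` and `x_{sb}`, exactly one digit produces a lift of `x_s`. -/
theorem exists_digit {x : F → UnitAddCircle} (hx : x ∈ principalGroup f) (s : F) {p q : ℝ}
    (hp : (p : UnitAddCircle) = x (s * gen 0)) (hq : (q : UnitAddCircle) = x (s * gen 1)) :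
    ∃ k : Fin 3, (((p + q + ((k : ℕ) : ℝ)) / 3 : ℝ) : UnitAddCircle) = x s := by
  obtain ⟨r, hr⟩ := QuotientAddGroup.mk_surjective (x s)
  replace hr : (r : UnitAddCircle) = x s := hr
  have h := (mem_principalGroup_iff x).1 hx s
  rw [← hp, ← hq, ← hr, ← AddCircle.coe_zsmul, ← AddCircle.coe_sub, ← AddCircle.coe_sub,
    AddCircle.coe_eq_zero_iff] at h
  obtain ⟨n, hn⟩ := h
  simp only [zsmul_eq_mul, mul_one, Int.cast_ofNat] at hn
  have h0 := Int.emod_nonneg n (by norm_num : (3 : ℤ) ≠ 0)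
  have h1 := Int.emod_lt_of_pos n (by norm_num : (0 : ℤ) < 3)
  -- Here r = (p + q + n)/3; replacing n by its residue mod 3 changes this by the integer n / 3.
  refine ⟨⟨(n % 3).toNat, by omega⟩, ?_⟩
  rw [← hr, ← sub_eq_zero, ← AddCircle.coe_sub, AddCircle.coe_eq_zero_iff]
  refine ⟨-(n / 3), ?_⟩
  have h2 : (((n % 3).toNat : ℕ) : ℝ) = ((n % 3 : ℤ) : ℝ) := by
    exact_mod_cast congrArg (Int.cast (R := ℝ)) (Int.toNat_of_nonneg h0)
  have h3 : ((n % 3 : ℤ) : ℝ) + 3 * ((n / 3 : ℤ) : ℝ) = n := by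
    exact_mod_cast Int.emod_add_mul_ediv n 3
  simp only [zsmul_eq_mul, mul_one, Int.cast_neg, h2]
  linarith

/-- Lifts of a point of `X_f` whose recurrence digits are admissible below a given height. -/
def admissibleLifts (x : F → UnitAddCircle) (n : ℕ) : Set (F → ℝ) :=
  {v | (∀ s, v s ∈ Icc (0 : ℝ) 2) ∧ (∀ s, (v s : UnitAddCircle) = x s) ∧
    ∀ s, height s < n → 3 * v s - v (s * gen 0) - v (s * gen 1) ∈
      range fun k : Fin 3 => ((k : ℕ) : ℝ)}

theorem admissibleLifts_nonempty {x : F → UnitAddCircle} (hx : x ∈ principalGroup f) (n : ℕ) :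
    (admissibleLifts x n).Nonempty := by
  have step (v : {v : F → ℝ // (∀ s, v s ∈ Icc (0 : ℝ) 2) ∧ ∀ s, (v s : UnitAddCircle) = x s}) :
      ∃ v' : {v : F → ℝ // (∀ s, v s ∈ Icc (0 : ℝ) 2) ∧ ∀ s, (v s : UnitAddCircle) = x s},
        ∀ s, 3 * v'.1 s - v.1 (s * gen 0) - v.1 (s * gen 1) ∈
          range fun k : Fin 3 => ((k : ℕ) : ℝ) := by
    obtain ⟨v, hv, hvx⟩ := v
    choose k hk using fun s => exists_digit hx s (hvx (s * gen 0)) (hvx (s * gen 1))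
    refine ⟨⟨fun s => (v (s * gen 0) + v (s * gen 1) + ((k s : ℕ) : ℝ)) / 3, fun s => ?_, hk⟩,
      fun s => ⟨k s, by ring⟩⟩
    -- The interval [0, 2] is preserved because (2 + 2 + 2)/3 = 2.
    have h0 := hv (s * gen 0)
    have h1 := hv (s * gen 1)
    have h2 : ((k s : ℕ) : ℝ) ≤ 2 := by exact_mod_cast Nat.le_of_lt_succ (k s).isLt
    have h3 : (0 : ℝ) ≤ ((k s : ℕ) : ℝ) := Nat.cast_nonneg _
    rw [mem_Icc] at h0 h1 ⊢
    constructor <;> linarith [h0.1, h0.2, h1.1, h1.2]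
  have base (s : F) : ∃ r : ℝ, r ∈ Icc (0 : ℝ) 2 ∧ (r : UnitAddCircle) = x s := by
    obtain ⟨r, hr⟩ := QuotientAddGroup.mk_surjective (x s)
    exact ⟨Int.fract r, ⟨Int.fract_nonneg r, (Int.fract_lt_one r).le.trans (by norm_num)⟩,
      (AddCircle.coe_fract r).trans hr⟩
  choose v₀ hv₀ hv₀x using base
  choose next hnext using step
  -- At s the iterate of index n - height s is used, which truncates to 0 from height n up. A
  -- generator raises the height by one, so below height n the values at s and at its successors
  -- come from consecutive iterates.
  let V (m : ℕ) := next^[m] ⟨v₀, hv₀, hv₀x⟩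
  refine ⟨fun s => (V (n - height s).toNat).1 s, fun s => (V _).2.1 s, fun s => (V _).2.2 s,
    fun s hs => ?_⟩
  obtain ⟨m, hm⟩ : ∃ m, (n - height s).toNat = m + 1 := ⟨(n - height s).toNat - 1, by omega⟩
  have hi (i) : (n - height (s * gen i)).toNat = m := by
    rw [height_mul, height_gen]; omega
  simp only [hi, hm, V, Function.iterate_succ_apply']
  exact hnext _ s

theorem isClosed_admissibleLifts (x : F → UnitAddCircle) (n : ℕ) :
    IsClosed (admissibleLifts x n) := by
  have h : admissibleLifts x n = (⋂ s, {v : F → ℝ | v s ∈ Icc (0 : ℝ) 2}) ∩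
      ((⋂ s, {v : F → ℝ | (v s : UnitAddCircle) = x s}) ∩
      ⋂ s, ⋂ _ : height s < n, {v : F → ℝ | 3 * v s - v (s * gen 0) - v (s * gen 1) ∈
        range fun k : Fin 3 => ((k : ℕ) : ℝ)}) := by
    ext v; simp [admissibleLifts]
  rw [h]
  refine (isClosed_iInter fun s => isClosed_Icc.preimage (continuous_apply s)).inter
    ((isClosed_iInter fun s => isClosed_eq ((AddCircle.continuous_mk' 1).comp (continuous_apply s))
      continuous_const).inter (isClosed_iInter fun s => isClosed_iInter fun _ => ?_))
  exact (finite_range _).isClosed.preimage (by fun_prop)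

theorem phi_surjective : Function.Surjective phi := by
  rintro ⟨x, hx⟩
  obtain ⟨v, hv⟩ := IsCompact.nonempty_iInter_of_sequence_nonempty_isCompact_isClosed
    (admissibleLifts x) (fun n v hv => ⟨hv.1, hv.2.1, fun s hs => hv.2.2 s (by push_cast; omega)⟩)
    (admissibleLifts_nonempty hx)
    ((isCompact_univ_pi fun _ : F => isCompact_Icc (a := (0 : ℝ)) (b := 2)).of_isClosed_subset
      (isClosed_admissibleLifts x 0) fun v hv s _ => hv.1 s) (isClosed_admissibleLifts x)
  rw [mem_iInter] at hv
  have hd (s : F) : ∃ k : Fin 3, ((k : ℕ) : ℝ) = 3 * v s - v (s * gen 0) - v (s * gen 1) :=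
    (hv ((height s).toNat + 1)).2.2 s (by push_cast; omega)
  choose d hd using hd
  refine ⟨d, Subtype.ext (funext fun s => ?_)⟩
  rw [phi_apply, ← eq_lift (d := d) (fun s => ((hv 0).1 s).1) (fun s => ((hv 0).1 s).2)
    (fun s => (hd s).symm.trans (by simp [Y.toInt]))]
  exact (hv 0).2.1 s

/-! ### The image of `ν` is Haar measure. -/

instance : IsProbabilityMeasure ν := by unfold ν; infer_instance

/-- Add `1` modulo `3` to the symbol at `t`. -/
def bump (t : F) (d : Y) : Y := Function.update d t (d t + 1)

theorem bump_self (t : F) (d : Y) : bump t d t = d t + 1 := by simp [bump]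

theorem bump_of_ne {t u : F} (h : u ≠ t) (d : Y) : bump t d u = d u := by simp [bump, h]

theorem uniform_map_equiv (e : Equiv.Perm (Fin 3)) :
    (PMF.uniformOfFintype (Fin 3)).toMeasure.map e = (PMF.uniformOfFintype (Fin 3)).toMeasure := by
  refine Measure.ext_of_singleton fun i => ?_
  rw [Measure.map_apply (measurable_of_finite _) (measurableSet_singleton i),
    ← Equiv.image_symm_eq_preimage, image_singleton,
    PMF.toMeasure_apply_singleton _ _ (measurableSet_singleton _),
    PMF.toMeasure_apply_singleton _ _ (measurableSet_singleton _)]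
  simp

theorem measurePreserving_bump (t : F) : MeasurePreserving (bump t) ν ν := by
  have h : bump t = fun (d : Y) u =>
      (if u = t then Equiv.addRight 1 else 1 : Equiv.Perm (Fin 3)) (d u) := by
    funext d u
    by_cases hu : u = t
    · subst hu; simp [bump_self]
    · simp [bump_of_ne hu, hu]
  have hm (u : F) : Measurable (if u = t then Equiv.addRight 1 else 1 : Equiv.Perm (Fin 3)) :=
    measurable_of_finite _
  refine ⟨?_, ?_⟩
  · rw [h]
    exact measurable_pi_lambda _ fun u => (hm u).comp (measurable_pi_apply u)
  · rw [h, ν, Measure.infinitePi_map_pi _ hm]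
    simp_rw [uniform_map_equiv]

theorem pairing_neg_right (x : F → UnitAddCircle) (g : MonoidAlgebra ℤ F) :
    pairing x (-g) = -pairing x g :=
  map_neg (AddMonoidHom.mk' (pairing x) (pairing_add_right x)) g

theorem pairing_zero_right (x : F → UnitAddCircle) : pairing x 0 = 0 :=
  map_zero (AddMonoidHom.mk' (pairing x) (pairing_add_right x))

/-- The character of `X_f` given by an element of the integral group ring. -/
def character (g : MonoidAlgebra ℤ F) : BoundedContinuousFunction (principalGroup f) ℂ :=
  BoundedContinuousFunction.mkOfCompact
    ⟨fun x => (AddCircle.toCircle (pairing x.1 g) : ℂ),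
      continuous_subtype_val.comp (AddCircle.continuous_toCircle.comp
        (continuous_finsetSum _ fun s _ =>
          ((continuous_apply s).comp continuous_subtype_val).zsmul _))⟩

theorem character_apply (g : MonoidAlgebra ℤ F) (x : principalGroup f) :
    character g x = (AddCircle.toCircle (pairing x.1 g) : ℂ) := rfl

theorem character_add_right (g : MonoidAlgebra ℤ F) (x y : principalGroup f) :
    character g (x + y) = character g x * character g y := by
  simp only [character_apply, AddSubgroup.coe_add, pairing_add_left, AddCircle.toCircle_add,
    Circle.coe_mul]

/-- The characters as a monoid homomorphism. -/
def characterHom : Multiplicative (MonoidAlgebra ℤ F) →*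
    BoundedContinuousFunction (principalGroup f) ℂ where
  toFun g := character g.toAdd
  map_one' := by
    ext x
    simp [character_apply, pairing_zero_right]
  map_mul' g h := by
    ext x
    simp [character_apply, pairing_add_right, AddCircle.toCircle_add]

theorem star_character (g : MonoidAlgebra ℤ F) : star (character g) = character (-g) := by
  ext x
  rw [character_apply, pairing_neg_right, AddCircle.toCircle_neg, Circle.coe_inv_eq_conj]
  rfl

/-- Characters are closed under products, so the algebra they generate is their linear span, and
span induction suffices for trigonometric polynomials. -/
theorem adjoin_character : Subalgebra.toSubmodule (Algebra.adjoin ℂ (range characterHom)) =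
    Submodule.span ℂ (range characterHom) := by
  rw [Algebra.adjoin_eq_span, ← MonoidHom.coe_mrange, Submonoid.closure_eq]

/-- The star algebra of trigonometric polynomials on `X_f`. -/
def trigPolynomials : StarSubalgebra ℂ (BoundedContinuousFunction (principalGroup f) ℂ) where
  toSubalgebra := Algebra.adjoin ℂ (range characterHom)
  star_mem' {p} hp := by
    change p ∈ Subalgebra.toSubmodule (Algebra.adjoin ℂ (range characterHom)) at hp
    change star p ∈ Subalgebra.toSubmodule (Algebra.adjoin ℂ (range characterHom))
    rw [adjoin_character] at hp ⊢
    induction hp using Submodule.span_induction with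
    | mem p hp =>
      obtain ⟨g, rfl⟩ := hp
      exact Submodule.subset_span ⟨g⁻¹, (star_character g.toAdd).symm⟩
    | zero => rw [star_zero]; exact Submodule.zero_mem _
    | add p q _ _ hp hq => rw [star_add]; exact Submodule.add_mem _ hp hq
    | smul c p _ hp => rw [star_smul]; exact Submodule.smul_mem _ _ hp

theorem mem_trigPolynomials {p : BoundedContinuousFunction (principalGroup f) ℂ} :
    p ∈ trigPolynomials ↔ p ∈ Submodule.span ℂ (range characterHom) := by
  rw [← adjoin_character]; rfl

instance : PolishSpace (principalGroup f) := (isClosed_principalGroup f).polishSpace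

instance : BorelSpace (principalGroup f) := Subtype.borelSpace _

/-- A finite measure on `X_f` is determined by its Fourier coefficients. -/
theorem ext_of_integral_character {P Q : Measure (principalGroup f)} [IsFiniteMeasure P]
    [IsFiniteMeasure Q] (h : ∀ g, ∫ x, character g x ∂P = ∫ x, character g x ∂Q) : P = Q := by
  refine ext_of_forall_mem_subalgebra_integral_eq_of_polish (𝕜 := ℂ) (A := trigPolynomials) ?_ ?_
  · intro x y hxy
    obtain ⟨s, hs⟩ : ∃ s, x.1 s ≠ y.1 s := by
      by_contra! hs
      exact hxy (Subtype.ext (funext hs))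
    refine ⟨_, ⟨_, ⟨character (MonoidAlgebra.single s 1), mem_trigPolynomials.2
      (Submodule.subset_span ⟨Multiplicative.ofAdd (MonoidAlgebra.single s 1), rfl⟩), rfl⟩, rfl⟩, ?_⟩
    intro hxy'
    change character _ x = character _ y at hxy'
    rw [character_apply, character_apply, pairing_single, pairing_single, one_smul, one_smul] at hxy'
    exact hs (AddCircle.injective_toCircle one_ne_zero (Subtype.ext hxy'))
  · intro p hp
    rw [mem_trigPolynomials] at hp
    induction hp using Submodule.span_induction with
    | mem p hp =>
      obtain ⟨g, rfl⟩ := hp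
      exact h g.toAdd
    | zero => simp
    | add p q _ _ hp hq =>
      simp only [BoundedContinuousFunction.coe_add, Pi.add_apply]
      rw [integral_add (p.integrable _) (q.integrable _),
        integral_add (p.integrable _) (q.integrable _), hp, hq]
    | smul c p _ hp =>
      simp only [BoundedContinuousFunction.coe_smul, integral_smul, hp]

/-- The coefficients of `g (f^*)⁻¹`. -/
def coefficient (g : MonoidAlgebra ℤ F) (t : F) : ℝ :=
  ∑ s ∈ g.coeff.support, g.coeff s • wΔ (t⁻¹ * s)

/-- Exchanging the finite sum over the support of g with the sum over t expresses the character
through the individual symbols of d, each with its own weight. -/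
theorem hasSum_pairing_phi (g : MonoidAlgebra ℤ F) (d : Y) :
    HasSum (fun t => d.toInt t • (coefficient g t : UnitAddCircle)) (pairing (phi d).1 g) := by
  have h (t : F) : d.toInt t • (coefficient g t : UnitAddCircle) =
      ∑ s ∈ g.coeff.support, g.coeff s • d.toInt t • xΔ (t⁻¹ * s) := by
    have h' : (coefficient g t : UnitAddCircle) =
        ∑ s ∈ g.coeff.support, g.coeff s • xΔ (t⁻¹ * s) :=
      map_sum (QuotientAddGroup.mk' (AddSubgroup.zmultiples (1 : ℝ))) _ _
    rw [h', Finset.smul_sum]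
    exact Finset.sum_congr rfl fun s _ => smul_comm _ _ _
  simp only [h, pairing_sum]
  exact hasSum_sum fun s _ => (hasSum_phi d s).const_smul (g.coeff s)

theorem coefficient_recurrence (g : MonoidAlgebra ℤ F) (t : F) :
    3 * coefficient g t - coefficient g (t * (gen 0)⁻¹) - coefficient g (t * (gen 1)⁻¹) =
      g.coeff t := by
  simp only [coefficient, Finset.mul_sum, ← Finset.sum_sub_distrib]
  have h (s : F) : 3 * g.coeff s • wΔ (t⁻¹ * s) - g.coeff s • wΔ ((t * (gen 0)⁻¹)⁻¹ * s) -
      g.coeff s • wΔ ((t * (gen 1)⁻¹)⁻¹ * s) = if t = s then (g.coeff s : ℝ) else 0 := by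
    have := wΔ_gen_mul (t⁻¹ * s)
    simp only [inv_mul_eq_one, mul_inv_rev, inv_inv, zsmul_eq_mul, mul_assoc] at this ⊢
    split_ifs at this ⊢ <;> linear_combination (g.coeff s : ℝ) * this
  simp only [h, Finset.sum_ite_eq, Finsupp.mem_support_iff]
  split_ifs with h0
  · rfl
  · simp_all

theorem coefficient_recurrence_circle (g : MonoidAlgebra ℤ F) (t : F) :
    (3 : ℤ) • (coefficient g t : UnitAddCircle) =
      coefficient g (t * (gen 0)⁻¹) + coefficient g (t * (gen 1)⁻¹) := by
  rw [← AddCircle.coe_zsmul, ← AddCircle.coe_add, ← sub_eq_zero, ← AddCircle.coe_sub,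
    AddCircle.coe_eq_zero_iff]
  refine ⟨g.coeff t, ?_⟩
  have := coefficient_recurrence g t
  simp only [zsmul_eq_mul, mul_one, Int.cast_ofNat]
  linarith

/-- If some coefficient is not an integer, then one of them is `±1/3` modulo one. -/
theorem exists_coefficient_torsion {g : MonoidAlgebra ℤ F}
    (hg : ∃ t, (coefficient g t : UnitAddCircle) ≠ 0) :
    ∃ t, (coefficient g t : UnitAddCircle) ≠ 0 ∧
      (3 : ℤ) • (coefficient g t : UnitAddCircle) = 0 := by
  by_contra! h
  obtain ⟨m, hm⟩ := (g.coeff.support.image height).bddBelow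
  -- Below the support of g all coefficients vanish, since `wΔ` lives at nonpositive height. If no
  -- nonzero coefficient were 3-torsion, the recurrence would carry this vanishing upwards one
  -- height at a time.
  have key (n : ℕ) : ∀ t, height t < m + n → (coefficient g t : UnitAddCircle) = 0 := by
    induction n with
    | zero =>
      intro t ht
      rw [coefficient, Finset.sum_eq_zero, AddCircle.coe_zero]
      intro s hs
      rw [smul_eq_zero]
      by_contra! hw
      have h1 := height_nonpos_of_wΔ_ne_zero hw.2
      have h2 := hm (Finset.mem_coe.2 (Finset.mem_image_of_mem height hs))
      rw [height_mul, height_inv] at h1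
      simp only [Nat.cast_zero] at ht
      omega
    | succ n ih =>
      intro t ht
      by_contra h0
      refine h t h0 ?_
      rw [coefficient_recurrence_circle, ih, ih, add_zero] <;>
      · rw [height_mul, height_inv, height_gen]
        push_cast at ht
        omega
  obtain ⟨t, ht⟩ := hg
  exact ht (key (height t - m + 1).toNat t (by omega))

theorem pairing_phi_bump {g : MonoidAlgebra ℤ F} {t : F}
    (ht : (3 : ℤ) • (coefficient g t : UnitAddCircle) = 0) (d : Y) :
    pairing (phi (bump t d)).1 g = coefficient g t + pairing (phi d).1 g := by
  have h := (hasSum_pairing_phi g (bump t d)).sub (hasSum_pairing_phi g d)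
  have h' := h.unique (hasSum_single t fun u hu => by simp [Y.toInt, bump_of_ne hu])
  rw [← sub_eq_iff_eq_add, h', ← sub_smul]
  simp only [Y.toInt, bump_self]
  generalize d t = i
  fin_cases i
  · simp
  · simp
  -- The symbol 2 wraps around to 0, a change of -2; this acts as +1 because 3c = 0.
  · simp only [Fin.reduceFinMk, Fin.reduceAdd, Fin.coe_ofNat_eq_mod]
    simpa using neg_eq_of_add_eq_zero_left (by rw [← ht]; abel)

theorem eq_zero_of_toCircle_mul_eq {c : UnitAddCircle} (hc : c ≠ 0) {z : ℂ}
    (h : z = AddCircle.toCircle c * z) : z = 0 := by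
  by_contra hz
  refine hc (AddCircle.injective_toCircle one_ne_zero ?_)
  rw [AddCircle.toCircle_zero]
  exact Subtype.ext (mul_right_cancel₀ hz (by rw [← h, Circle.coe_one, one_mul]))

theorem integral_character_phi {g : MonoidAlgebra ℤ F} {t : F}
    (h0 : (coefficient g t : UnitAddCircle) ≠ 0)
    (ht : (3 : ℤ) • (coefficient g t : UnitAddCircle) = 0) :
    ∫ d, character g (phi d) ∂ν = 0 := by
  have hc : Continuous fun d => character g (phi d) := (character g).continuous.comp continuous_phi
  have h : ∫ d, character g (phi d) ∂ν =
      (AddCircle.toCircle (coefficient g t : UnitAddCircle) : ℂ) *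
        ∫ d, character g (phi d) ∂ν := by
    conv_lhs => rw [← (measurePreserving_bump t).map_eq]
    rw [integral_map (measurePreserving_bump t).measurable.aemeasurable
      hc.measurable.aestronglyMeasurable, ← integral_const_mul]
    simp only [character_apply, pairing_phi_bump ht, AddCircle.toCircle_add, Circle.coe_mul]
  exact eq_zero_of_toCircle_mul_eq h0 h

/-- Translation by `phi (bump t 0) - phi 0`, where the character has the value `toCircle` of the
coefficient, plays the part that `bump t` plays for `ν`. -/
theorem integral_character_haar {g : MonoidAlgebra ℤ F} {t : F}
    (h0 : (coefficient g t : UnitAddCircle) ≠ 0)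
    (ht : (3 : ℤ) • (coefficient g t : UnitAddCircle) = 0) :
    ∫ x, character g x ∂principalHaar f = 0 := by
  have h : ∫ x, character g x ∂principalHaar f =
      (AddCircle.toCircle (coefficient g t : UnitAddCircle) : ℂ) *
        ∫ x, character g x ∂principalHaar f := by
    unfold principalHaar
    conv_lhs => rw [← integral_add_left_eq_self _ (phi (bump t 0) - phi 0)]
    rw [← integral_const_mul]
    have hp : pairing (phi (bump t 0) - phi 0).1 g = coefficient g t := by
      rw [sub_eq_add_neg, AddSubgroup.coe_add, AddSubgroup.coe_neg, pairing_add_left,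
        pairing_neg_left, pairing_phi_bump ht, add_neg_cancel_right]
    simp only [character_add_right]
    simp only [character_apply, hp]
  exact eq_zero_of_toCircle_mul_eq h0 h

instance : IsProbabilityMeasure (principalHaar f) :=
  ⟨by
    simpa [principalHaar] using Measure.addHaarMeasure_self
      (K₀ := (⊤ : TopologicalSpace.PositiveCompacts (principalGroup f)))⟩

instance : IsProbabilityMeasure (ν.map phi) :=
  Measure.isProbabilityMeasure_map continuous_phi.measurable.aemeasurable

theorem map_phi : ν.map phi = principalHaar f := by
  refine ext_of_integral_character fun g => ?_
  by_cases hg : ∃ t, (coefficient g t : UnitAddCircle) ≠ 0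
  · obtain ⟨t, h0, ht⟩ := exists_coefficient_torsion hg
    rw [integral_character_haar h0 ht, integral_map continuous_phi.measurable.aemeasurable
      (character g).continuous.measurable.aestronglyMeasurable, integral_character_phi h0 ht]
  -- With all weights zero the character is 1 on the image of `phi`, which is all of X_f.
  · push Not at hg
    have h (x : principalGroup f) : character g x = 1 := by
      obtain ⟨d, rfl⟩ := phi_surjective x
      have := hasSum_pairing_phi g d
      simp only [hg, smul_zero] at this
      rw [character_apply, this.unique hasSum_zero, AddCircle.toCircle_zero, Circle.coe_one]
    simp [h]

/-! ### Percolation has probability zero. -/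

/-- The configurations for which there is a subtree of depth `n` of the tree of descendants of `s`
in which a vertex with symbol `1` has both its children, a vertex with symbol `j` has at least
one child, and no other symbol occurs. -/
def percolates (j : Fin 3) : ℕ → F → Set Y
  | 0, _ => univ
  | n + 1, s =>
    ({d | d s = 1} ∩ (percolates j n (s * gen 0) ∩ percolates j n (s * gen 1))) ∪
      ({d | d s = j} ∩ (percolates j n (s * gen 0) ∪ percolates j n (s * gen 1)))

theorem isClosed_symbol (s : F) (i : Fin 3) : IsClosed {d : Y | d s = i} :=
  isClosed_eq (continuous_apply s) continuous_const

theorem isClosed_percolates (j : Fin 3) (n : ℕ) (s : F) : IsClosed (percolates j n s) := by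
  induction n generalizing s with
  | zero => exact isClosed_univ
  | succ n ih =>
    exact ((isClosed_symbol s 1).inter ((ih _).inter (ih _))).union
      ((isClosed_symbol s j).inter ((ih _).union (ih _)))

/-- The event inspects only s and its descendants, all of height at least that of s. -/
theorem bump_preimage_percolates (j : Fin 3) (n : ℕ) {t s : F} (h : height t < height s) :
    bump t ⁻¹' percolates j n s = percolates j n s := by
  induction n generalizing s with
  | zero => rfl
  | succ n ih =>
    have hi (i) : height t < height (s * gen i) := by
      rw [height_mul, height_gen]; omega
    have hs (d : Y) : bump t d s = d s := bump_of_ne (by rintro rfl; exact h.false) d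
    simp only [percolates, preimage_union, preimage_inter, ih (hi _), preimage_ofPred_eq, hs]

theorem shift_preimage_percolates (j : Fin 3) (n : ℕ) (u s : F) :
    shift u ⁻¹' percolates j n (u * s) = percolates j n s := by
  induction n generalizing s with
  | zero => rfl
  | succ n ih =>
    simp only [percolates, preimage_union, preimage_inter, mul_assoc, ih, preimage_ofPred_eq, shift,
      inv_mul_cancel_left]

/-- The symbol at `s` is independent of events which do not depend on it. -/
theorem measureReal_symbol_inter {s : F} {A : Set Y} (hA : MeasurableSet A)
    (hs : bump s ⁻¹' A = A) (i : Fin 3) : ν.real ({d | d s = i} ∩ A) = ν.real A / 3 := by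
  have hm (i : Fin 3) : MeasurableSet ({d : Y | d s = i} ∩ A) :=
    (isClosed_symbol s i).measurableSet.inter hA
  -- `bump s` preserves `ν` and `A` and permutes the three symbol events cyclically, so the three
  -- pieces of `A` have equal measure.
  have hstep (i : Fin 3) : ν.real ({d | d s = i + 1} ∩ A) = ν.real ({d | d s = i} ∩ A) := by
    rw [← (measurePreserving_bump s).measureReal_preimage (hm (i + 1)).nullMeasurableSet,
      preimage_inter, hs, preimage_ofPred_eq]
    simp only [bump_self, add_left_inj]
  have h1 : ν.real ({d | d s = 1} ∩ A) = _ := hstep 0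
  have h2 : ν.real ({d | d s = 2} ∩ A) = _ := hstep 1
  have hsum : ν.real A = ∑ i : Fin 3, ν.real ({d | d s = i} ∩ A) := by
    rw [← measureReal_biUnion_finset (fun i _ j _ hij => ?_) (fun i _ => hm i)]
    · congr 1
      ext d; simp
    · exact disjoint_left.2 fun d hi hj => hij (hi.1.symm.trans hj.1)
  rw [Fin.sum_univ_three] at hsum
  fin_cases i <;> simp <;> linarith

/-- With A and B the events at the two children, the bound is (P(A ∩ B) + P(A ∪ B))/3 = (P(A) +
P(B))/3. Independence of A and B from each other is not needed, only from the symbol at s. -/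
theorem measureReal_percolates_le (j : Fin 3) (n : ℕ) (s : F) :
    ν.real (percolates j n s) ≤ (2 / 3) ^ n := by
  induction n generalizing s with
  | zero => simp [percolates]
  | succ n ih =>
    set A := percolates j n (s * gen 0)
    set B := percolates j n (s * gen 1)
    have hAm : MeasurableSet A := (isClosed_percolates j n _).measurableSet
    have hBm : MeasurableSet B := (isClosed_percolates j n _).measurableSet
    have hi (i) : height s < height (s * gen i) := by
      rw [height_mul, height_gen]; omega
    have hA' : bump s ⁻¹' A = A := bump_preimage_percolates j n (hi 0)
    have hB' : bump s ⁻¹' B = B := bump_preimage_percolates j n (hi 1)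
    have h1 := measureReal_union_le (μ := ν) ({d | d s = 1} ∩ (A ∩ B)) ({d | d s = j} ∩ (A ∪ B))
    rw [measureReal_symbol_inter (hAm.inter hBm) (by rw [preimage_inter, hA', hB']),
      measureReal_symbol_inter (hAm.union hBm) (by rw [preimage_union, hA', hB'])] at h1
    have h2 := measureReal_union_add_inter (μ := ν) (s := A) hBm
    have h3 := ih (s * gen 0)
    have h4 := ih (s * gen 1)
    change ν.real (({d | d s = 1} ∩ (A ∩ B)) ∪ ({d | d s = j} ∩ (A ∪ B))) ≤ _
    rw [pow_succ]
    linarith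

/-- The configurations percolating to infinity from some vertex. -/
def exceptional : Set Y :=
  ⋃ s : F, (⋂ n, percolates 2 n s) ∪ ⋂ n, percolates 0 n s

theorem measurableSet_exceptional : MeasurableSet exceptional :=
  .iUnion fun s => (isClosed_iInter fun n => isClosed_percolates 2 n s).measurableSet.union
    (isClosed_iInter fun n => isClosed_percolates 0 n s).measurableSet

theorem measure_iInter_percolates (j : Fin 3) (s : F) : ν (⋂ n, percolates j n s) = 0 := by
  rw [← measureReal_eq_zero_iff]
  refine le_antisymm (ge_of_tendsto' (tendsto_pow_atTop_nhds_zero_of_lt_one (r := (2 / 3 : ℝ))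
    (by norm_num) (by norm_num)) fun n => ?_) measureReal_nonneg
  exact (measureReal_mono (iInter_subset _ n)).trans (measureReal_percolates_le j n s)

theorem measure_exceptional : ν exceptional = 0 :=
  measure_iUnion_null fun s => measure_union_null (measure_iInter_percolates 2 s)
    (measure_iInter_percolates 0 s)

theorem shift_mem_exceptional_iff (u : F) (d : Y) : shift u d ∈ exceptional ↔ d ∈ exceptional := by
  have h (j n s) : shift u d ∈ percolates j n (u * s) ↔ d ∈ percolates j n s := by
    rw [← shift_preimage_percolates j n u s]; rfl
  simp only [exceptional, mem_iUnion, mem_union, mem_iInter]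
  rw [← (Equiv.mulLeft u).exists_congr_right]
  simp only [Equiv.coe_mulLeft, h]

/-! ### Injectivity off the exceptional set. -/

/-- An integral solution of the recurrence dominated by the symbols of `d` is nonpositive unless
`d` percolates. -/
theorem nonpos_of_not_percolates {d : Y} {j : Fin 3} (hd : ∀ s, d ∉ ⋂ n, percolates j n s)
    {k δ : F → ℤ} (hk : ∀ s, k s ≤ 2) (h : ∀ s, 3 * k s = k (s * gen 0) + k (s * gen 1) + δ s)
    (hδ : ∀ s, δ s ≤ 0 ∨ (δ s ≤ 1 ∧ d s = 1) ∨ (δ s ≤ 2 ∧ d s = j)) (s : F) : k s ≤ 0 := by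
  -- If k_s = 2, then 6 ≤ 4 + δ_s forces δ_s = 2 and both children to have value 2, so this value
  -- never dies out.
  have step2 (n : ℕ) : ∀ s, k s = 2 → d ∈ percolates j n s := by
    induction n with
    | zero => exact fun s _ => mem_univ d
    | succ n ih =>
      intro s hs
      have h' := h s
      have h0 := hk (s * gen 0)
      have h1 := hk (s * gen 1)
      rcases hδ s with hδ | ⟨hδ, _⟩ | ⟨hδ, hj⟩
      · omega
      · omega
      · exact Or.inr ⟨hj, Or.inl (ih _ (by omega))⟩
  have hk1 (s) : k s ≤ 1 := by
    by_contra hs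
    have := hk s
    exact hd s (mem_iInter.2 fun n => step2 n s (by omega))
  -- Now k ≤ 1. If k_s = 1, the children's values sum to 3 - δ_s: δ_s = 1 forces both to be 1, and
  -- δ_s = 2 forces at least one. This is the rule defining `percolates`.
  have step1 (n : ℕ) : ∀ s, k s = 1 → d ∈ percolates j n s := by
    induction n with
    | zero => exact fun s _ => mem_univ d
    | succ n ih =>
      intro s hs
      have h' := h s
      have h0 := hk1 (s * gen 0)
      have h1 := hk1 (s * gen 1)
      rcases hδ s with hδ | ⟨hδ, hj⟩ | ⟨hδ, hj⟩
      · omega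
      · exact Or.inl ⟨hj, ih _ (by omega), ih _ (by omega)⟩
      · refine Or.inr ⟨hj, ?_⟩
        by_cases h2 : k (s * gen 0) = 1
        · exact Or.inl (ih _ h2)
        · exact Or.inr (ih _ (by omega))
  by_contra hs
  have := hk1 s
  exact hd s (mem_iInter.2 fun n => step1 n s (by omega))

theorem eq_of_phi_eq {d d' : Y} (hd : d ∉ exceptional) (h : phi d = phi d') : d = d' := by
  have hk (s : F) : ∃ k : ℤ, (k : ℝ) = lift d s - lift d' s := by
    have hs : (lift d s : UnitAddCircle) = lift d' s := congrFun (congrArg Subtype.val h) s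
    rw [← sub_eq_zero, ← AddCircle.coe_sub, AddCircle.coe_eq_zero_iff] at hs
    simpa using hs
  choose k hk using hk
  have hrec (s : F) : 3 * k s = k (s * gen 0) + k (s * gen 1) + (d.toInt s - d'.toInt s) := by
    have h1 := lift_recurrence d s
    have h2 := lift_recurrence d' s
    have : (3 * k s : ℝ) = k (s * gen 0) + k (s * gen 1) + (d.toInt s - d'.toInt s) := by
      rw [hk, hk, hk]; linarith
    exact_mod_cast this
  have hle (s : F) : k s ≤ 2 := by
    have : (k s : ℝ) ≤ 2 := by linarith [hk s, lift_le_two d s, lift_nonneg d' s]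
    exact_mod_cast this
  have hge (s : F) : -k s ≤ 2 := by
    have : (-k s : ℝ) ≤ 2 := by linarith [hk s, lift_le_two d' s, lift_nonneg d s]
    exact_mod_cast this
  simp only [exceptional, mem_iUnion, mem_union, not_exists, not_or] at hd
  have hfin (s : F) : (d.toInt s = 0 ∧ d s = 0) ∨ (d.toInt s = 1 ∧ d s = 1) ∨
      (d.toInt s = 2 ∧ d s = 2) := by
    simp only [Y.toInt]
    generalize d s = i
    fin_cases i <;> simp
  -- Since d - d' ≤ d, the forcing term can reach 2 only at symbol 2 of d, hence j = 2.
  have hpos (s) : k s ≤ 0 := by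
    refine nonpos_of_not_percolates (fun s => (hd s).1) hle hrec (fun s => ?_) s
    have := d'.toInt_nonneg s
    rcases hfin s with ⟨h1, h2⟩ | ⟨h1, h2⟩ | ⟨h1, h2⟩
    · exact Or.inl (by omega)
    · exact Or.inr (Or.inl ⟨by omega, h2⟩)
    · exact Or.inr (Or.inr ⟨by omega, h2⟩)
  -- Since d' - d ≤ 2 - d, symbol 0 of d takes over the part of 2, so both signs are controlled by d
  -- alone.
  have hneg (s) : -k s ≤ 0 := by
    refine nonpos_of_not_percolates (k := fun s => -k s) (δ := fun s => d'.toInt s - d.toInt s)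
      (fun s => (hd s).2) hge (fun s => by linarith [hrec s]) (fun s => ?_) s
    have := d'.toInt_le_two s
    rcases hfin s with ⟨h1, h2⟩ | ⟨h1, h2⟩ | ⟨h1, h2⟩
    · exact Or.inr (Or.inr ⟨by omega, h2⟩)
    · exact Or.inr (Or.inl ⟨by omega, h2⟩)
    · exact Or.inl (by omega)
  refine Y.toInt_injective (funext fun s => ?_)
  have h0 (s) : k s = 0 := le_antisymm (hpos s) (by linarith [hneg s])
  have := hrec s
  rw [h0, h0, h0] at this
  omega

theorem injOn_phi : InjOn phi exceptionalᶜ := fun _ hd _ _ h => eq_of_phi_eq hd h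

/-! ### The measurable isomorphism. -/

open TopologicalSpace in
instance : PolishSpace Y :=
  have : SecondCountableTopology Y := inferInstance
  have : IsCompletelyMetrizableSpace Y := IsCompletelyMetrizableSpace.pi_countable
  inferInstance

theorem isMeasurableIsomorphism_phi :
    IsMeasurableIsomorphism (fun s : F => shift s) ν (fun s : F => principalAction f s)
      (principalHaar f) phi := by
  refine ⟨⟨continuous_phi.measurable, map_phi⟩, ?_⟩
  have hE := measurableSet_exceptional.compl
  -- Lusin–Souslin: a continuous map that is injective on a Borel subset of a Polish space is a
  -- measurable embedding of that subset, so its inverse extends measurably.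
  obtain ⟨ψ, hψ, hψφ⟩ := (continuous_phi.continuousOn.measurableEmbedding hE
    injOn_phi).exists_measurable_extend measurable_subtype_coe fun _ => ⟨0⟩
  have hinv (d) (hd : d ∈ exceptionalᶜ) : ψ (phi d) = d := congrFun hψφ ⟨d, hd⟩
  have hX : MeasurableSet (phi '' exceptionalᶜ) :=
    hE.image_of_continuousOn_injOn continuous_phi.continuousOn injOn_phi
  have hshift (s : F) (d) (hd : d ∈ exceptionalᶜ) : shift s d ∈ exceptionalᶜ :=
    fun h => hd ((shift_mem_exceptional_iff s d).1 h)
  refine ⟨exceptionalᶜ, phi '' exceptionalᶜ, ψ, hE, ?_, hshift, hX, ?_, ?_,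
    injOn_phi.bijOn_image, ⟨hinv, ?_⟩, hψ, fun s d _ => phi_shift s d⟩
  · rw [compl_compl, measure_exceptional]
  · rw [← map_phi, Measure.map_apply continuous_phi.measurable hX.compl]
    refine measure_mono_null (fun d hd => ?_) measure_exceptional
    by_contra h
    exact hd ⟨d, h, rfl⟩
  · rintro s _ ⟨d, hd, rfl⟩
    exact ⟨shift s d, hshift s d hd, phi_shift s d⟩
  · rintro _ ⟨d, hd, rfl⟩
    rw [hinv d hd]

end AlgAct

end

theorem theorem3p1 :
    -- the real series defining `d · w^Δ` converge
    (∀ (d : AlgAct.Y) (s : AlgAct.F),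
      Summable fun t : AlgAct.F => d.toInt t • AlgAct.wΔ (t⁻¹ * s)) ∧
    -- the homoclinic map takes its values in `X_f`
    ∃ φ : AlgAct.Y → AlgAct.principalGroup AlgAct.f,
      (∀ d : AlgAct.Y, (φ d : AlgAct.F → UnitAddCircle) = AlgAct.homoclinicMap d.toInt) ∧
      -- `φ(d) = d · x^Δ`, with convergent sums in the circle
      (∀ (d : AlgAct.Y) (s : AlgAct.F),
        Summable fun t : AlgAct.F => d.toInt t • AlgAct.xΔ (t⁻¹ * s)) ∧
      (∀ d : AlgAct.Y,
        (φ d : AlgAct.F → UnitAddCircle) = AlgAct.formalProduct d.toInt AlgAct.xΔ) ∧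
      Continuous φ ∧
      (∀ (s : AlgAct.F) (d : AlgAct.Y),
        φ (AlgAct.shift s d) = AlgAct.principalAction AlgAct.f s (φ d)) ∧
      Function.Surjective φ ∧
      (∃ E : Set AlgAct.Y, AlgAct.ν E = 0 ∧ Set.InjOn φ Eᶜ) ∧
      AlgAct.ν.map φ = AlgAct.principalHaar AlgAct.f ∧
      -- hence `φ` is a measurable isomorphism of the Bernoulli 3-shift with `α_f`
      AlgAct.IsMeasurableIsomorphism
        (fun s : AlgAct.F => AlgAct.shift s) AlgAct.ν
        (fun s : AlgAct.F => AlgAct.principalAction AlgAct.f s)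
        (AlgAct.principalHaar AlgAct.f) φ := by
  exact ⟨AlgAct.summable_toInt_smul, AlgAct.phi, fun _ => rfl,
    fun d s => (AlgAct.hasSum_phi d s).summable,
    fun d => funext fun s => (AlgAct.hasSum_phi d s).tsum_eq.symm, AlgAct.continuous_phi,
    AlgAct.phi_shift, AlgAct.phi_surjective,
    ⟨AlgAct.exceptional, AlgAct.measure_exceptional, AlgAct.injOn_phi⟩, AlgAct.map_phi,
    AlgAct.isMeasurableIsomorphism_phi⟩
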